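/- Let $\mathcal{A} \subset \mathbb{C}$ denote the field of all algebraic numbers (complex numbers algebraic over $\mathbb{Q}$), and let $\ln$ denote the principal value of the complex logarithm, with imaginary part in $(-\pi, \pi]$. For any $\alpha, \beta \in \mathcal{A}$ with $\alpha \neq 0, 1$ and $i\beta \notin \mathbb{Q}$, the numbers $1$, $\cos(\beta \ln \alpha)$ and $\sin(\beta \ln \alpha)$ are linearly independent over $\mathcal{A}$. In particular, both $\cos(\beta \ln \alpha)$ and $\sin(\beta \ln \alpha)$ are transcendental over $\mathbb{Q}$. -/

import Mathlib

open NumberField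

/-! Put w = β ln α. Since iβ is algebraic and irrational and ln α ≠ 0, Gelfond–Schneider
(`transcendental_exp_mul`) makes e^{iw} = exp(ln α · iβ) transcendental. By Euler's formulas, an
algebraic relation among 1, cos w, sin w becomes, after multiplication by 2e^{iw}, a quadratic
equation for e^{iw} with algebraic coefficients, so they all vanish.

Gelfond–Schneider is proved by Schneider's method, without derivatives. If exp l, β and exp(lβ) lie
in a number field, Siegel's lemma gives a nonzero polynomial F in z and e^{lz} with small integral
coefficients and zeros at u + vβ for u, v < n² (`exists_auxiliary_expPoly`). Zeros at all u, v < T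
make F of size T^{O(nT)} 2^{-T²} at the next points by the Schwarz lemma, while conjugates of the
value, cleared of denominators, are at most T^{O(nT)}. As n² ≤ T, the norm of this algebraic integer
is below 1, so the value is 0 (`expPoly_eq_zero_of_forall_lt`). By induction F vanishes at every u +
vβ, hence identically, against the algebraic independence of z and e^{lz}. -/

/-! ### Schwarz lemma for entire functions with many zeros -/

/-- An entire function vanishing on a finite set is divisible by the corresponding product of
linear factors. -/
theorem exists_entire_eq_prod_sub_mul {f : ℂ → ℂ} (hf : Differentiable ℂ f) (Z : Finset ℂ)
    (hZ : ∀ ζ ∈ Z, f ζ = 0) :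
    ∃ g : ℂ → ℂ, Differentiable ℂ g ∧ ∀ z, f z = (∏ ζ ∈ Z, (z - ζ)) * g z := by
  induction Z using Finset.induction_on with
  | empty => exact ⟨f, hf, fun z => by simp⟩
  | insert a s ha ih =>
    obtain ⟨g, hg, hfg⟩ := ih fun ζ hζ => hZ ζ (Finset.mem_insert_of_mem hζ)
    have hga : g a = 0 := by
      have h := hZ a (Finset.mem_insert_self a s)
      rw [hfg a, mul_eq_zero] at h
      refine h.resolve_left (Finset.prod_ne_zero_iff.mpr fun ζ hζ => sub_ne_zero.mpr ?_)
      rintro rfl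
      exact ha hζ
    refine ⟨dslope g a, ?_, fun z => ?_⟩
    · rw [← differentiableOn_univ] at hg ⊢
      exact (Complex.differentiableOn_dslope Filter.univ_mem).mpr hg
    · have h := sub_smul_dslope g a z
      rw [hga, sub_zero, smul_eq_mul] at h
      rw [hfg z, Finset.prod_insert ha, ← h]
      ring

/-- A Schwarz lemma for an entire function with many zeros in a disc. -/
theorem norm_le_mul_half_pow_of_zeros {f : ℂ → ℂ} (hf : Differentiable ℂ f) {Z : Finset ℂ}
    (hZ : ∀ ζ ∈ Z, f ζ = 0) {r B : ℝ} (hr : 0 < r) (hZr : ∀ ζ ∈ Z, ‖ζ‖ ≤ r)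
    (hB : ∀ z : ℂ, ‖z‖ = 5 * r → ‖f z‖ ≤ B) {w : ℂ} (hw : ‖w‖ ≤ r) :
    ‖f w‖ ≤ B * (1 / 2) ^ Z.card := by
  obtain ⟨g, hg, hfg⟩ := exists_entire_eq_prod_sub_mul hf Z hZ
  -- On the circle of radius 5r each factor is at least 4r, and at w it is at most 2r, so every zero
  -- gains a factor 1/2.
  have hgB : ‖g w‖ ≤ B / (4 * r) ^ Z.card := by
    refine Complex.norm_le_of_forall_mem_frontier_norm_le (U := Metric.ball (0 : ℂ) (5 * r))
      Metric.isBounded_ball hg.diffContOnCl (fun z hz => ?_) (subset_closure ?_)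
    · rw [frontier_ball _ (by positivity), mem_sphere_zero_iff_norm] at hz
      rw [le_div_iff₀ (by positivity)]
      refine le_trans ?_ (hB z hz)
      rw [hfg z, norm_mul, norm_prod, mul_comm]
      gcongr
      rw [← Finset.prod_const]
      refine Finset.prod_le_prod (fun _ _ => by positivity) fun ζ hζ => ?_
      have := norm_sub_norm_le z ζ
      linarith [hZr ζ hζ]
    · rw [mem_ball_zero_iff]
      linarith
  have hprod : ‖∏ ζ ∈ Z, (w - ζ)‖ ≤ (2 * r) ^ Z.card := by
    rw [norm_prod, ← Finset.prod_const]
    refine Finset.prod_le_prod (fun _ _ => by positivity) fun ζ hζ => ?_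
    have := norm_sub_le w ζ
    linarith [hZr ζ hζ]
  calc ‖f w‖ = ‖∏ ζ ∈ Z, (w - ζ)‖ * ‖g w‖ := by rw [hfg w, norm_mul]
    _ ≤ (2 * r) ^ Z.card * (B / (4 * r) ^ Z.card) := by gcongr
    _ = B * (1 / 2) ^ Z.card := by
      rw [show 4 * r = 2 * (2 * r) by ring, mul_pow 2 (2 * r)]
      field_simp
      rw [mul_assoc, ← mul_pow]
      norm_num

/-! ### Exponential polynomials -/

/-- The exponential polynomial `∑ p i j * z ^ i * exp (l * z) ^ j`. -/
noncomputable def expPoly {L J : ℕ} (l : ℂ) (p : Fin L × Fin J → ℂ) (z : ℂ) : ℂ :=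
  ∑ k, p k * z ^ (k.1 : ℕ) * Complex.exp (l * z) ^ (k.2 : ℕ)

theorem differentiable_expPoly {L J : ℕ} (l : ℂ) (p : Fin L × Fin J → ℂ) :
    Differentiable ℂ (expPoly l p) := by
  unfold expPoly
  fun_prop

theorem fin_coeff_eq_zero_of_infinite_zeros {L : ℕ} (q : Fin L → ℂ) {s : Set ℂ} (hs : s.Infinite)
    (h : ∀ x ∈ s, ∑ i, q i * x ^ (i : ℕ) = 0) : q = 0 := by
  have key : (∑ i : Fin L, Polynomial.C (q i) * Polynomial.X ^ (i : ℕ)) = 0 := by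
    refine Polynomial.eq_zero_of_infinite_isRoot _ (hs.mono fun x hx => ?_)
    simpa [Polynomial.IsRoot, Polynomial.eval_finsetSum] using h x hx
  funext i
  have := congrArg (fun P => Polynomial.coeff P (i : ℕ)) key
  simpa [Polynomial.finsetSum_coeff, Polynomial.coeff_X_pow, Fin.val_inj] using this

/-- The functions `z` and `exp (l * z)` are algebraically independent. -/
theorem eq_zero_of_expPoly_eq_zero {L J : ℕ} {l : ℂ} (hl : l ≠ 0) {p : Fin L × Fin J → ℂ}
    (h : ∀ z, expPoly l p z = 0) : p = 0 := by
  have hpi : (2 * Real.pi * Complex.I : ℂ) ≠ 0 := Complex.two_pi_I_ne_zero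
  have h1 : ∀ z : ℂ, ∀ i : Fin L, ∑ j, p (i, j) * Complex.exp (l * z) ^ (j : ℕ) = 0 := by
    intro z
    -- Translating z by periods of e^{lz} freezes the exponential, leaving a polynomial in z with
    -- infinitely many roots.
    refine congrFun (fin_coeff_eq_zero_of_infinite_zeros
      (fun i => ∑ j, p (i, j) * Complex.exp (l * z) ^ (j : ℕ))
      (s := Set.range fun k : ℤ => z + k * (2 * Real.pi * Complex.I / l)) ?_ ?_)
    · refine Set.infinite_range_of_injective fun k k' hk => ?_
      have := mul_right_cancel₀ (div_ne_zero hpi hl) (add_left_cancel hk)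
      exact_mod_cast this
    · rintro _ ⟨k, rfl⟩
      have hk := h (z + k * (2 * Real.pi * Complex.I / l))
      have he : Complex.exp (l * (z + k * (2 * Real.pi * Complex.I / l))) =
          Complex.exp (l * z) := by
        rw [show l * (z + k * (2 * Real.pi * Complex.I / l)) =
          l * z + k * (2 * Real.pi * Complex.I) by field_simp]
        exact Complex.exp_periodic.int_mul k _
      rw [expPoly, he, Fintype.sum_prod_type] at hk
      rw [← hk]
      refine Finset.sum_congr rfl fun i _ => ?_
      rw [Finset.sum_mul]
      exact Finset.sum_congr rfl fun j _ => by ring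
  funext ⟨i, j⟩
  refine congrFun (fin_coeff_eq_zero_of_infinite_zeros (fun j => p (i, j))
    (s := {0}ᶜ) (Set.finite_singleton (0 : ℂ)).infinite_compl ?_) j
  intro x hx
  have := h1 (Complex.log x / l) i
  rwa [mul_div_cancel₀ _ hl, Complex.exp_log hx] at this

theorem norm_expPoly_le {L J : ℕ} (l : ℂ) {p : Fin L × Fin J → ℂ} {P R : ℝ}
    (hp : ∀ k, ‖p k‖ ≤ P) (hR : 1 ≤ R) {z : ℂ} (hz : ‖z‖ ≤ R) :
    ‖expPoly l p z‖ ≤ (L * J : ℕ) * (P * R ^ L * Real.exp (‖l‖ * R) ^ J) := by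
  have : ∀ k ∈ (Finset.univ : Finset (Fin L × Fin J)),
      ‖p k * z ^ (k.1 : ℕ) * Complex.exp (l * z) ^ (k.2 : ℕ)‖
        ≤ P * R ^ L * Real.exp (‖l‖ * R) ^ J := by
    intro k _
    have hP : 0 ≤ P := (norm_nonneg _).trans (hp k)
    have h1 : ‖z ^ (k.1 : ℕ)‖ ≤ R ^ L := by
      rw [norm_pow]
      exact (pow_le_pow_left₀ (norm_nonneg _) hz _).trans (pow_le_pow_right₀ hR k.1.2.le)
    have h2 : ‖Complex.exp (l * z) ^ (k.2 : ℕ)‖ ≤ Real.exp (‖l‖ * R) ^ J := by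
      rw [norm_pow]
      have h3 : ‖Complex.exp (l * z)‖ ≤ Real.exp (‖l‖ * R) := by
        refine (Complex.norm_exp_le_exp_norm _).trans (Real.exp_le_exp.mpr ?_)
        rw [norm_mul]
        gcongr
      exact (pow_le_pow_left₀ (norm_nonneg _) h3 _).trans
        (pow_le_pow_right₀ (Real.one_le_exp (by positivity)) k.2.2.le)
    rw [norm_mul, norm_mul]
    gcongr
    exact hp k
  refine (norm_sum_le_of_le _ this).trans (le_of_eq ?_)
  simp [Finset.sum_const, Finset.card_univ]

/-! ### Growth comparison and Siegel's lemma -/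

/-- `2 ^ T` eventually dominates `T ^ (k * n)` in the range `n ^ 2 ≤ T`. -/
theorem exists_pow_mul_lt_two_pow (k : ℕ) :
    ∃ N : ℕ, ∀ n T : ℕ, N ≤ n → n ^ 2 ≤ T → T ^ (k * n) < 2 ^ T := by
  -- With s = ⌊√T⌋ one has n ≤ s and T ≤ (s + 1)², so it suffices to raise this comparison to the
  -- power s.
  have h : ∀ᶠ s : ℕ in Filter.atTop, (s + 1) ^ (2 * k) < 2 ^ s := by
    have h1 := tendsto_pow_const_div_const_pow_of_one_lt (2 * k) (one_lt_two : (1 : ℝ) < 2)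
    have h2 := (Filter.tendsto_add_atTop_iff_nat 1).mpr h1
    have h3 := h2.eventually (gt_mem_nhds (show (0 : ℝ) < 1 / 2 by norm_num))
    filter_upwards [h3] with s hs
    rw [div_lt_iff₀ (by positivity), pow_succ (2 : ℝ)] at hs
    have : ((s + 1 : ℕ) : ℝ) ^ (2 * k) < 2 ^ s := by linarith
    exact_mod_cast this
  obtain ⟨N, hN⟩ := Filter.eventually_atTop.mp h
  refine ⟨N + 1, fun n T hn hT => ?_⟩
  have hns : n ≤ T.sqrt := by
    rw [Nat.le_sqrt]
    nlinarith
  have hT1 : T ≤ (T.sqrt + 1) ^ 2 := by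
    have := Nat.lt_succ_sqrt' T
    simpa using this.le
  calc T ^ (k * n) ≤ ((T.sqrt + 1) ^ 2) ^ (k * n) := Nat.pow_le_pow_left hT1 _
    _ = ((T.sqrt + 1) ^ (2 * k)) ^ n := by rw [← pow_mul, ← pow_mul]; ring_nf
    _ ≤ ((T.sqrt + 1) ^ (2 * k)) ^ T.sqrt := Nat.pow_le_pow_right (by positivity) hns
    _ < (2 ^ T.sqrt) ^ T.sqrt := Nat.pow_lt_pow_left (hN _ (by omega)) (by omega)
    _ = 2 ^ (T.sqrt * T.sqrt) := by rw [← pow_mul]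
    _ ≤ 2 ^ T := Nat.pow_le_pow_right (by norm_num) (Nat.sqrt_le T)

/-- Siegel's lemma for twice as many unknowns as equations, with a constant depending only on the
number field. -/
theorem exists_siegel_const (K : Type*) [Field K] [NumberField K] :
    ∃ C : ℝ, 0 ≤ C ∧ ∀ {ι κ : Type} [Fintype ι] [Fintype κ] (e : Matrix ι κ (𝓞 K)) (A : ℝ),
      0 < Fintype.card ι → Fintype.card κ = 2 * Fintype.card ι → e ≠ 0 →
      (∀ i l, house (algebraMap (𝓞 K) K (e i l)) ≤ A) →
      ∃ ξ : κ → 𝓞 K, ξ ≠ 0 ∧ e.mulVec ξ = 0 ∧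
        ∀ l, house (ξ l : K) ≤ C * (Fintype.card κ * A) := by
  classical
  have key : ∃ C : ℝ, ∀ {ι κ : Type} [Fintype ι] [Fintype κ] (e : Matrix ι κ (𝓞 K)) (A : ℝ),
      0 < Fintype.card ι → Fintype.card κ = 2 * Fintype.card ι → e ≠ 0 →
      (∀ i l, house (algebraMap (𝓞 K) K (e i l)) ≤ A) →
      ∃ ξ : κ → 𝓞 K, ξ ≠ 0 ∧ e.mulVec ξ = 0 ∧
        ∀ l, house (ξ l : K) ≤ C * (C * Fintype.card κ * A) ^
          ((Fintype.card ι : ℝ) / (Fintype.card κ - Fintype.card ι)) :=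
    ⟨_, fun e A hι hκ he hA =>
      house.exists_ne_zero_int_vec_house_le K e he hι (by omega) rfl hA rfl⟩
  obtain ⟨C, hC⟩ := key
  -- With twice as many unknowns as equations the Siegel exponent is 1, which leaves C · C.
  refine ⟨C ^ 2, sq_nonneg C, fun {ι κ} _ _ e A hι hκ he hA => ?_⟩
  obtain ⟨ξ, h0, hξ, hle⟩ := hC e A hι hκ he hA
  refine ⟨ξ, h0, hξ, fun l => (hle l).trans (le_of_eq ?_)⟩
  have hι' : (Fintype.card ι : ℝ) ≠ 0 := by exact_mod_cast hι.ne'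
  rw [hκ, Nat.cast_mul, show ((2 : ℕ) : ℝ) * Fintype.card ι - Fintype.card ι = Fintype.card ι by
    push_cast; ring, div_self hι', Real.rpow_one]
  ring

/-! ### Integral values in a number field -/

section

variable {K : Type*} [Field K] [NumberField K]

theorem house_natCast (d : ℕ) : house (d : K) = d := by
  have := house_intCast (K := K) (d : ℤ)
  simpa using this

/-- Liouville's inequality: the norm of a nonzero algebraic integer is a nonzero integer, and the
house bounds all conjugates other than the one at `φ`. -/
theorem one_le_norm_mul_house_pow {x : 𝓞 K} (hx : x ≠ 0) (φ : K →+* ℂ) :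
    1 ≤ ‖φ x‖ * house (x : K) ^ (Module.finrank ℚ K - 1) := by
  refine le_trans ?_ (norm_norm_le_norm_mul_house_pow (x : K) φ)
  have h : Algebra.norm ℤ x ≠ 0 := Algebra.norm_ne_zero_iff.mpr hx
  have h1 : (1 : ℤ) ≤ |Algebra.norm ℤ x| := Int.one_le_abs h
  rw [← Algebra.coe_norm_int x, Int.norm_cast_rat, Int.norm_eq_abs]
  exact_mod_cast h1

/-- The integral multiple `d ^ (L + 2 * T * J) * (u + v * b / d) ^ i * ((a / d) ^ u * (c / d) ^ v) ^ j`
of a value of the monomial `z ^ i * exp (l * z) ^ j`. -/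
noncomputable def monomialValue (d : ℕ) (a b c : 𝓞 K) (L J T u v i j : ℕ) : 𝓞 K :=
  d ^ (L - i) * (u * d + v * b) ^ i * (d ^ (2 * T * J - j * (u + v)) * a ^ (j * u) * c ^ (j * v))

theorem mul_add_le_two_mul {J T u v j : ℕ} (hu : u ≤ T) (hv : v ≤ T) (hj : j ≤ J) :
    j * (u + v) ≤ 2 * T * J := by
  calc j * (u + v) ≤ J * (T + T) := by gcongr
    _ = 2 * T * J := by ring

/-- The powers of `d` pad the exponents to exactly L and 2TJ, so the bound is uniform in u, v, i, j,
as Siegel's lemma needs. -/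
theorem house_monomialValue_le {d : ℕ} {a b c : 𝓞 K} {H : ℝ} (hH : 1 ≤ H) (hd : (d : ℝ) ≤ H)
    (ha : house (a : K) ≤ H) (hb : house (b : K) ≤ H) (hc : house (c : K) ≤ H)
    {L J T u v i j : ℕ} (hT : 1 ≤ T) (hu : u ≤ T) (hv : v ≤ T) (hi : i ≤ L) (hj : j ≤ J) :
    house (monomialValue d a b c L J T u v i j : K) ≤ (2 * T * H) ^ L * H ^ (2 * T * J) := by
  have hT' : (1 : ℝ) ≤ T := by exact_mod_cast hT
  have hpow : ∀ (x : K) (B : ℝ) (n : ℕ), house x ≤ B → house (x ^ n) ≤ B ^ n := fun x B n h =>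
    (house_pow_le x n).trans (pow_le_pow_left₀ (house_nonneg x) h n)
  have hmul : ∀ (x y : K) (B D : ℝ), house x ≤ B → house y ≤ D → house (x * y) ≤ B * D :=
    fun x y B D hx hy => (house_mul_le x y).trans
      (mul_le_mul hx hy (house_nonneg y) ((house_nonneg x).trans hx))
  have hd' : house (d : K) ≤ H := (house_natCast d).trans_le hd
  have hlin : house ((u : K) * d + v * b) ≤ 2 * T * H := by
    refine (house_add_le _ _).trans ?_
    have h1 := hmul u d T H ((house_natCast u).trans_le (by exact_mod_cast hu)) hd'
    have h2 := hmul v b T H ((house_natCast v).trans_le (by exact_mod_cast hv)) hb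
    linarith
  have hcoe : (monomialValue d a b c L J T u v i j : K) =
      (d : K) ^ (L - i) * ((u : K) * d + v * b) ^ i *
        ((d : K) ^ (2 * T * J - j * (u + v)) * (a : K) ^ (j * u) * (c : K) ^ (j * v)) := by
    simp [monomialValue]
  rw [hcoe]
  have hH' : H ≤ 2 * T * H := by nlinarith
  refine hmul _ _ _ _ ?_ ?_
  · refine (hmul _ _ _ _ (hpow _ (2 * T * H) (L - i) (hd'.trans hH')) (hpow _ _ i hlin)).trans
      (le_of_eq ?_)
    rw [← pow_add, Nat.sub_add_cancel hi]
  · refine (hmul _ _ _ _ (hmul _ _ _ _ (hpow _ _ _ hd') (hpow _ _ _ ha))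
      (hpow _ _ _ hc)).trans (le_of_eq ?_)
    rw [← pow_add, ← pow_add, add_assoc, ← mul_add,
      Nat.sub_add_cancel (mul_add_le_two_mul hu hv hj)]

theorem map_monomialValue {d : ℕ} {a b c : 𝓞 K} (φ : K →+* ℂ) {l β : ℂ}
    (ha : φ a = d * Complex.exp l) (hb : φ b = d * β) (hc : φ c = d * Complex.exp (l * β))
    {L J T u v i j : ℕ} (hu : u ≤ T) (hv : v ≤ T) (hi : i ≤ L) (hj : j ≤ J) :
    φ (monomialValue d a b c L J T u v i j) = (d : ℂ) ^ (L + 2 * T * J) *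
      ((u + v * β) ^ i * Complex.exp (l * (u + v * β)) ^ j) := by
  have he : Complex.exp (l * (u + v * β)) = Complex.exp l ^ u * Complex.exp (l * β) ^ v := by
    rw [← Complex.exp_nat_mul, ← Complex.exp_nat_mul, ← Complex.exp_add]
    ring_nf
  have hcoe : φ (monomialValue d a b c L J T u v i j) =
      (d : ℂ) ^ (L - i) * ((u : ℂ) * d + v * φ b) ^ i *
        ((d : ℂ) ^ (2 * T * J - j * (u + v)) * φ a ^ (j * u) * φ c ^ (j * v)) := by
    simp [monomialValue]
  have h1 : L + 2 * T * J = (L - i) + i + ((2 * T * J - j * (u + v)) + j * u + j * v) := by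
    rw [Nat.sub_add_cancel hi, add_assoc (_ - _), ← mul_add,
      Nat.sub_add_cancel (mul_add_le_two_mul hu hv hj)]
  rw [hcoe, ha, hb, hc, he, h1, show (u : ℂ) * d + v * (d * β) = d * (u + v * β) by ring]
  simp only [mul_pow, pow_add, pow_mul]
  ring

/-- The integral multiple of the value at `u + v * b / d` of the exponential polynomial with
coefficients `ξ`. -/
noncomputable def expPolyValue (d : ℕ) (a b c : 𝓞 K) {L J : ℕ} (ξ : Fin L × Fin J → 𝓞 K)
    (T u v : ℕ) : 𝓞 K :=
  ∑ k, monomialValue d a b c L J T u v k.1 k.2 * ξ k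

theorem house_expPolyValue_le {d : ℕ} {a b c : 𝓞 K} {H : ℝ} (hH : 1 ≤ H) (hd : (d : ℝ) ≤ H)
    (ha : house (a : K) ≤ H) (hb : house (b : K) ≤ H) (hc : house (c : K) ≤ H)
    {L J T u v : ℕ} (hT : 1 ≤ T) (hu : u ≤ T) (hv : v ≤ T) {ξ : Fin L × Fin J → 𝓞 K} {P : ℝ}
    (hξ : ∀ k, house (ξ k : K) ≤ P) :
    house (expPolyValue d a b c ξ T u v : K) ≤
      (L * J : ℕ) * ((2 * T * H) ^ L * H ^ (2 * T * J) * P) := by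
  have hcoe : (expPolyValue d a b c ξ T u v : K) =
      ∑ k : Fin L × Fin J, (monomialValue d a b c L J T u v k.1 k.2 : K) * (ξ k : K) := by
    simp [expPolyValue]
  rw [hcoe]
  refine (house_sum_le_sum_house _ _).trans ?_
  refine (Finset.sum_le_card_nsmul _ _ ((2 * T * H) ^ L * H ^ (2 * T * J) * P)
    fun k _ => ?_).trans (le_of_eq ?_)
  · exact (house_mul_le _ _).trans (mul_le_mul
      (house_monomialValue_le hH hd ha hb hc hT hu hv k.1.2.le k.2.2.le) (hξ k)
      (house_nonneg _) (by positivity))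
  · simp [Finset.card_univ]

theorem map_expPolyValue {d : ℕ} {a b c : 𝓞 K} (φ : K →+* ℂ) {l β : ℂ}
    (ha : φ a = d * Complex.exp l) (hb : φ b = d * β) (hc : φ c = d * Complex.exp (l * β))
    {L J T u v : ℕ} (hu : u ≤ T) (hv : v ≤ T) (ξ : Fin L × Fin J → 𝓞 K) :
    φ (expPolyValue d a b c ξ T u v) = (d : ℂ) ^ (L + 2 * T * J) *
      expPoly l (fun k => φ (ξ k)) (u + v * β) := by
  have hcoe : φ (expPolyValue d a b c ξ T u v) =
      ∑ k : Fin L × Fin J, φ (monomialValue d a b c L J T u v k.1 k.2) * φ (ξ k) := by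
    simp [expPolyValue]
  rw [hcoe, expPoly, Finset.mul_sum]
  refine Finset.sum_congr rfl fun k _ => ?_
  rw [map_monomialValue φ ha hb hc hu hv k.1.2.le k.2.2.le]
  ring

end

/-! ### Analytic upper bound and extrapolation -/

theorem norm_natCast_add_mul_le (β : ℂ) {T u v : ℕ} (hu : u ≤ T) (hv : v ≤ T) :
    ‖(u + v * β : ℂ)‖ ≤ T * (1 + ‖β‖) := by
  refine (norm_add_le _ _).trans ?_
  rw [norm_mul, Complex.norm_natCast, Complex.norm_natCast, mul_add, mul_one]
  gcongr

/-- An exponential polynomial vanishing at all `u + v * β` with `u, v < T` is small on the disc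
spanned by these points. -/
theorem norm_expPoly_le_of_zeros {L J : ℕ} {l β : ℂ} {p : Fin L × Fin J → ℂ}
    (hβ : ∀ u v u' v' : ℕ, (u : ℂ) + v * β = u' + v' * β → u = u' ∧ v = v')
    {P : ℝ} (hp : ∀ k, ‖p k‖ ≤ P) {T : ℕ} (hT : 1 ≤ T) (hβT : 5 * (1 + ‖β‖) ≤ T)
    (hexpT : Real.exp (‖l‖ * (5 * (1 + ‖β‖))) ≤ T)
    (hz : ∀ u v : ℕ, u < T → v < T → expPoly l p (u + v * β) = 0)
    {w : ℂ} (hw : ‖w‖ ≤ T * (1 + ‖β‖)) :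
    ‖expPoly l p w‖ ≤ (L * J : ℕ) * (P * (T : ℝ) ^ (2 * L + T * J)) * (1 / 2) ^ (T * T) := by
  classical
  have ht : (1 : ℝ) ≤ T := by exact_mod_cast hT
  have hr : 0 < T * (1 + ‖β‖) := by positivity
  -- Every quantity is turned into a power of T: the radius is at most T², and the exponential on
  -- the circle at most T^T.
  have hR : 5 * (T * (1 + ‖β‖)) ≤ (T : ℝ) ^ 2 := by nlinarith
  have hR1 : 1 ≤ 5 * (T * (1 + ‖β‖)) := by nlinarith [norm_nonneg β]
  set Z : Finset ℂ :=
    (Finset.range T ×ˢ Finset.range T).image fun w => (w.1 : ℂ) + w.2 * β with hZ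
  have hcard : Z.card = T * T := by
    rw [hZ, Finset.card_image_of_injective, Finset.card_product, Finset.card_range]
    rintro ⟨u, v⟩ ⟨u', v'⟩ h
    exact Prod.ext_iff.mpr (hβ u v u' v' h)
  have hmem : ∀ ζ ∈ Z, ∃ u v : ℕ, u < T ∧ v < T ∧ (u : ℂ) + v * β = ζ := by
    intro ζ hζ
    obtain ⟨⟨u, v⟩, huv, rfl⟩ := Finset.mem_image.mp hζ
    simp only [Finset.mem_product, Finset.mem_range] at huv
    exact ⟨u, v, huv.1, huv.2, rfl⟩
  rw [← hcard]
  refine norm_le_mul_half_pow_of_zeros (differentiable_expPoly _ _) (Z := Z) ?_ hr ?_ ?_ hw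
  · intro ζ hζ
    obtain ⟨u, v, hu, hv, rfl⟩ := hmem ζ hζ
    exact hz u v hu hv
  · intro ζ hζ
    obtain ⟨u, v, hu, hv, rfl⟩ := hmem ζ hζ
    exact norm_natCast_add_mul_le β hu.le hv.le
  · intro z hz
    refine (norm_expPoly_le l hp hR1 hz.le).trans ?_
    have hexp : Real.exp (‖l‖ * (5 * (T * (1 + ‖β‖)))) ≤ (T : ℝ) ^ T := by
      rw [show ‖l‖ * (5 * (T * (1 + ‖β‖))) = T * (‖l‖ * (5 * (1 + ‖β‖))) by ring,
        Real.exp_nat_mul]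
      gcongr
    rw [pow_add, pow_mul, pow_mul, ← mul_assoc P]
    rcases isEmpty_or_nonempty (Fin L × Fin J) with he | ⟨⟨k⟩⟩
    · have : L * J = 0 := by
        have := Fintype.card_eq_zero_iff.mpr he
        rwa [Fintype.card_prod, Fintype.card_fin, Fintype.card_fin] at this
      simp [this]
    · have : 0 ≤ P := (norm_nonneg _).trans (hp k)
      gcongr

section

variable {K : Type*} [Field K] [NumberField K]

/-- The extrapolation step of Schneider's method: if the exponential polynomial vanishes at all
`u + v * β` with `u, v < T`, then it vanishes at those with `u, v ≤ T`. -/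
theorem expPoly_eq_zero_of_forall_lt {d : ℕ} {a b c : 𝓞 K} (φ : K →+* ℂ) {l β : ℂ} (hd0 : d ≠ 0)
    (ha : φ a = d * Complex.exp l) (hb : φ b = d * β) (hc : φ c = d * Complex.exp (l * β))
    (hβ : ∀ u v u' v' : ℕ, (u : ℂ) + v * β = u' + v' * β → u = u' ∧ v = v')
    {n T : ℕ} {H : ℝ} (hH : 1 ≤ H) (hd : (d : ℝ) ≤ H)
    (hha : house (a : K) ≤ H) (hhb : house (b : K) ≤ H) (hhc : house (c : K) ≤ H)
    (hn : 1 ≤ n) (hT : 2 ≤ T) (hnT : n ^ 2 ≤ T) (hHT : H ≤ T) (hβT : 5 * (1 + ‖β‖) ≤ T)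
    (hexpT : Real.exp (‖l‖ * (5 * (1 + ‖β‖))) ≤ T)
    (hpow : T ^ (25 * Module.finrank ℚ K * n) < 2 ^ T)
    {ξ : Fin (2 * n ^ 3) × Fin n → 𝓞 K} (hξ : ∀ k, house (ξ k : K) ≤ (T : ℝ) ^ (13 * (n * T)))
    (hz : ∀ u v : ℕ, u < T → v < T → expPoly l (fun k => φ (ξ k)) (u + v * β) = 0)
    {u v : ℕ} (hu : u ≤ T) (hv : v ≤ T) : expPoly l (fun k => φ (ξ k)) (u + v * β) = 0 := by
  by_contra hne
  have ht2 : (2 : ℝ) ≤ T := by exact_mod_cast hT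
  have ht : (1 : ℝ) ≤ T := by linarith
  have ht0 : (0 : ℝ) ≤ T := by linarith
  have hm1 : 1 ≤ n * T := Nat.mul_pos (by omega) (by omega)
  have hn3 : n ^ 3 ≤ n * T := by
    calc n ^ 3 = n * n ^ 2 := by ring
      _ ≤ n * T := by gcongr
  have hmT : T * n = n * T := mul_comm _ _
  have hq : ((2 * n ^ 3 * n : ℕ) : ℝ) ≤ (T : ℝ) ^ 3 := by
    have : 2 * n ^ 3 * n ≤ T ^ 3 := by
      calc 2 * n ^ 3 * n = 2 * (n ^ 2) ^ 2 := by ring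
        _ ≤ T * T ^ 2 := by gcongr
        _ = T ^ 3 := by ring
    exact_mod_cast this
  set x := expPolyValue d a b c ξ T u v with hx
  have hφx := map_expPolyValue φ ha hb hc hu hv ξ
  have hd0' : (d : ℂ) ≠ 0 := by exact_mod_cast hd0
  have hx0 : x ≠ 0 := by
    intro h
    rw [← hx, h, RingOfIntegers.coe_eq_algebraMap, map_zero, map_zero] at hφx
    exact mul_ne_zero (pow_ne_zero _ hd0') hne hφx.symm
  -- Since n³ ≤ nT and 1 ≤ nT, the exponents add up to 3 + 6 + 2 + 13 = 24 times nT; likewise 3 + 13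
  -- + 4 + 1 = 21 in `hF`, and clearing denominators adds 4 in `hφxle`.
  have hhouse : house (x : K) ≤ (T : ℝ) ^ (24 * (n * T)) := by
    refine (house_expPolyValue_le hH hd hha hhb hhc (by omega) hu hv hξ).trans ?_
    calc _ ≤ (T : ℝ) ^ 3 * (((T : ℝ) ^ 3) ^ (2 * n ^ 3) * (T : ℝ) ^ (2 * T * n) *
          (T : ℝ) ^ (13 * (n * T))) := by
          gcongr
          calc 2 * (T : ℝ) * H ≤ T * T * T := by gcongr
            _ = (T : ℝ) ^ 3 := by ring
      _ = (T : ℝ) ^ (3 + (3 * (2 * n ^ 3) + 2 * T * n + 13 * (n * T))) := by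
          rw [← pow_mul, ← pow_add, ← pow_add, ← pow_add]
      _ ≤ _ := pow_le_pow_right₀ ht (by rw [mul_assoc 2 T n, hmT]; omega)
  have hF : ‖expPoly l (fun k => φ (ξ k)) (u + v * β)‖ ≤
      (T : ℝ) ^ (21 * (n * T)) * (1 / 2) ^ (T * T) := by
    refine (norm_expPoly_le_of_zeros hβ (fun k => (norm_embedding_le_house _ φ).trans (hξ k))
      (by omega) hβT hexpT hz (norm_natCast_add_mul_le β hu hv)).trans ?_
    gcongr ?_ * _
    calc _ ≤ (T : ℝ) ^ 3 * ((T : ℝ) ^ (13 * (n * T)) * (T : ℝ) ^ (2 * (2 * n ^ 3) + T * n)) := by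
          gcongr
      _ = (T : ℝ) ^ (3 + (13 * (n * T) + (2 * (2 * n ^ 3) + T * n))) := by
          rw [← pow_add, ← pow_add]
      _ ≤ _ := pow_le_pow_right₀ ht (by rw [hmT]; omega)
  have hφxle : ‖φ x‖ ≤ (T : ℝ) ^ (25 * (n * T)) * (1 / 2) ^ (T * T) := by
    rw [hφx, norm_mul, norm_pow, Complex.norm_natCast]
    calc _ ≤ (T : ℝ) ^ (2 * n ^ 3 + 2 * T * n) *
          ((T : ℝ) ^ (21 * (n * T)) * (1 / 2) ^ (T * T)) := by
          gcongr
          exact_mod_cast hd.trans hHT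
      _ ≤ (T : ℝ) ^ (4 * (n * T)) * ((T : ℝ) ^ (21 * (n * T)) * (1 / 2) ^ (T * T)) := by
          gcongr ?_ * _
          exact pow_le_pow_right₀ ht (by rw [mul_assoc 2 T n, hmT]; omega)
      _ = _ := by rw [← mul_assoc, ← pow_add]; congr 2; ring
  have hD : 0 < Module.finrank ℚ K := Module.finrank_pos
  -- With D the degree of K, 25 + 24(D − 1) ≤ 25D: this is the constant in `hpow`.
  have hlt : (T : ℝ) ^ (25 * (n * T)) * (1 / 2) ^ (T * T) *
      ((T : ℝ) ^ (24 * (n * T))) ^ (Module.finrank ℚ K - 1) < 1 := by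
    have h1 : (T : ℝ) ^ (25 * (n * T)) * ((T : ℝ) ^ (24 * (n * T))) ^ (Module.finrank ℚ K - 1) ≤
        ((T : ℝ) ^ (25 * Module.finrank ℚ K * n)) ^ T := by
      rw [← pow_mul, ← pow_add, ← pow_mul]
      refine pow_le_pow_right₀ ht ?_
      obtain ⟨D, hD'⟩ := Nat.exists_eq_succ_of_ne_zero hD.ne'
      rw [hD', Nat.succ_sub_one, Nat.succ_eq_add_one]
      nlinarith [Nat.zero_le (D * (n * T))]
    have h2 : ((T : ℝ) ^ (25 * Module.finrank ℚ K * n)) ^ T < (2 ^ T) ^ T := by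
      refine pow_lt_pow_left₀ (by exact_mod_cast hpow) (by positivity) (by omega)
    have h3 : (0 : ℝ) < (1 / 2) ^ (T * T) := by positivity
    calc _ = (T : ℝ) ^ (25 * (n * T)) * ((T : ℝ) ^ (24 * (n * T))) ^ (Module.finrank ℚ K - 1) *
          (1 / 2) ^ (T * T) := by ring
      _ < (2 ^ T) ^ T * (1 / 2) ^ (T * T) := mul_lt_mul_of_pos_right (h1.trans_lt h2) h3
      _ = 1 := by rw [← pow_mul, ← mul_pow]; norm_num
  refine absurd (one_le_norm_mul_house_pow hx0 φ) (not_le.mpr (lt_of_le_of_lt ?_ hlt))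
  have := house_nonneg (x : K)
  gcongr

/-- Siegel's lemma gives a nonzero exponential polynomial with small coefficients vanishing at all
`u + v * β` with `u, v < n ^ 2`. -/
theorem exists_auxiliary_expPoly {d : ℕ} {a b c : 𝓞 K} (φ : K →+* ℂ) {l β : ℂ} (hd0 : d ≠ 0)
    (ha : φ a = d * Complex.exp l) (hb : φ b = d * β) (hc : φ c = d * Complex.exp (l * β))
    {H : ℝ} (hH : 1 ≤ H) (hd : (d : ℝ) ≤ H)
    (hha : house (a : K) ≤ H) (hhb : house (b : K) ≤ H) (hhc : house (c : K) ≤ H) :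
    ∃ C : ℝ, ∀ n : ℕ, 2 ≤ n → H ≤ n → C ≤ n →
      ∃ ξ : Fin (2 * n ^ 3) × Fin n → 𝓞 K, ξ ≠ 0 ∧
        (∀ k, house (ξ k : K) ≤ ((n ^ 2 : ℕ) : ℝ) ^ (13 * (n * n ^ 2))) ∧
        ∀ u v : ℕ, u < n ^ 2 → v < n ^ 2 →
          expPoly l (fun k => φ (ξ k)) (u + v * β) = 0 := by
  obtain ⟨C, hC0, hC⟩ := exists_siegel_const K
  refine ⟨C, fun n hn hHn hCn => ?_⟩
  have hn1 : 1 ≤ n := by omega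
  have hd0' : (d : ℂ) ≠ 0 := by exact_mod_cast hd0
  have hL : 0 < 2 * n ^ 3 := by positivity
  have hS : 0 < n ^ 2 := by positivity
  -- There are 2n³ · n unknowns for n² · n² equations, the ratio 2 required by
  -- `exists_siegel_const`.
  let e : Matrix (Fin (n ^ 2) × Fin (n ^ 2)) (Fin (2 * n ^ 3) × Fin n) (𝓞 K) := fun w k =>
    monomialValue d a b c (2 * n ^ 3) n (n ^ 2) w.1 w.2 k.1 k.2
  -- The entry with u = v = i = j = 0 is a power of `d`.
  have he : e ≠ 0 := by
    intro h
    have h0 : monomialValue d a b c (2 * n ^ 3) n (n ^ 2) 0 0 0 0 = 0 :=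
      congrFun (congrFun h (⟨0, hS⟩, ⟨0, hS⟩)) (⟨0, hL⟩, ⟨0, hn1⟩)
    have h1 := map_monomialValue (L := 2 * n ^ 3) (J := n) (T := n ^ 2) φ ha hb hc
      (Nat.zero_le _) (Nat.zero_le _) (Nat.zero_le _) (Nat.zero_le _)
    rw [h0, RingOfIntegers.coe_eq_algebraMap, map_zero, map_zero, pow_zero, pow_zero, mul_one, mul_one] at h1
    exact pow_ne_zero _ hd0' h1.symm
  obtain ⟨ξ, hξ0, hξ, hle⟩ := hC e ((2 * (n ^ 2 : ℕ) * H) ^ (2 * n ^ 3) * H ^ (2 * n ^ 2 * n))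
    (by simp only [Fintype.card_prod, Fintype.card_fin]; positivity)
    (by simp only [Fintype.card_prod, Fintype.card_fin]; ring) he
    (fun w k => house_monomialValue_le hH hd hha hhb hhc hS w.1.2.le w.2.2.le k.1.2.le k.2.2.le)
  refine ⟨ξ, hξ0, fun k => (hle k).trans ?_, fun u v hu hv => ?_⟩
  · have hnS : n ≤ n ^ 2 := Nat.le_self_pow (by norm_num) n
    have hcard : ((Fintype.card (Fin (2 * n ^ 3) × Fin n) : ℕ) : ℝ) ≤ ((n ^ 2 : ℕ) : ℝ) ^ 3 := by
      have : 2 * n ^ 3 * n ≤ (n ^ 2) ^ 3 := by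
        calc 2 * n ^ 3 * n ≤ n ^ 2 * n ^ 3 * n := by gcongr; omega
          _ = (n ^ 2) ^ 3 := by ring
      simp only [Fintype.card_prod, Fintype.card_fin]
      exact_mod_cast this
    have hnS' : (n : ℝ) ≤ ((n ^ 2 : ℕ) : ℝ) := by exact_mod_cast hnS
    have hS2 : (2 : ℝ) ≤ ((n ^ 2 : ℕ) : ℝ) := by exact_mod_cast hn.trans hnS
    have hn3 : n * n ^ 2 = n ^ 3 := by ring
    have hn3' : 2 * n ^ 2 * n = 2 * n ^ 3 := by ring
    have hn3pos : 1 ≤ n ^ 3 := Nat.one_le_pow _ _ hn1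
    rw [hn3, hn3']
    set t : ℝ := ((n ^ 2 : ℕ) : ℝ)
    calc _ ≤ t * (t ^ 3 * ((t ^ 3) ^ (2 * n ^ 3) * t ^ (2 * n ^ 3))) := by
          gcongr
          · exact hCn.trans hnS'
          · calc 2 * t * H ≤ t * t * t := by gcongr; exact hHn.trans hnS'
              _ = t ^ 3 := by ring
          · exact hHn.trans hnS'
      _ = t ^ (1 + (3 + (3 * (2 * n ^ 3) + 2 * n ^ 3))) := by
          rw [← pow_mul, ← pow_add, ← pow_add, pow_add t 1, pow_one]
      _ ≤ _ := pow_le_pow_right₀ (by linarith) (by omega)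
  · have h1 : expPolyValue d a b c ξ (n ^ 2) u v = 0 := congrFun hξ (⟨u, hu⟩, ⟨v, hv⟩)
    have h2 := map_expPolyValue φ ha hb hc hu.le hv.le ξ
    rw [h1, RingOfIntegers.coe_eq_algebraMap, map_zero, map_zero] at h2
    exact (mul_eq_zero.mp h2.symm).resolve_left (pow_ne_zero _ hd0')

/-- An exponential polynomial vanishing at all `u + v * β` with `u, v : ℕ` is zero. -/
theorem expPoly_eq_zero_of_forall_nat {L J : ℕ} {l β : ℂ} {p : Fin L × Fin J → ℂ}
    (hβ : ∀ u v u' v' : ℕ, (u : ℂ) + v * β = u' + v' * β → u = u' ∧ v = v')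
    (h : ∀ u v : ℕ, expPoly l p (u + v * β) = 0) (z : ℂ) : expPoly l p z = 0 := by
  set P : ℝ := ∑ k, ‖p k‖ with hPdef
  have hP : ∀ k, ‖p k‖ ≤ P := fun k =>
    Finset.single_le_sum (f := fun k => ‖p k‖) (fun _ _ => norm_nonneg _) (Finset.mem_univ k)
  have hP0 : 0 ≤ P := Finset.sum_nonneg fun _ _ => norm_nonneg _
  -- The extra 2 pays for two factors T: one absorbs L · J · P, the other the n that gives the decay
  -- 1/n.
  obtain ⟨N, hN⟩ := exists_pow_mul_lt_two_pow (2 + 2 * L + J)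
  have hbound : ∀ᶠ n : ℕ in Filter.atTop, ‖expPoly l p z‖ ≤ 1 / n := by
    filter_upwards [Filter.eventually_ge_atTop N, Filter.eventually_ge_atTop 1,
      (tendsto_natCast_atTop_atTop (R := ℝ)).eventually ((Filter.eventually_ge_atTop ‖z‖).and
      ((Filter.eventually_ge_atTop ((L * J : ℕ) * P)).and
      ((Filter.eventually_ge_atTop (5 * (1 + ‖β‖))).and
      (Filter.eventually_ge_atTop (Real.exp (‖l‖ * (5 * (1 + ‖β‖))))))))] with n hnN hn1 hn
    obtain ⟨hnz, hnP, hnβ, hnl⟩ := hn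
    set T : ℕ := n ^ 2 with hTdef
    have hnT : n ≤ T := Nat.le_self_pow (by norm_num) n
    have hnT' : (n : ℝ) ≤ T := by exact_mod_cast hnT
    have hT1 : 1 ≤ T := hn1.trans hnT
    have ht : (1 : ℝ) ≤ T := by exact_mod_cast hT1
    have hn0 : (0 : ℝ) < n := by exact_mod_cast hn1
    have h1 := norm_expPoly_le_of_zeros hβ hP hT1 (hnβ.trans hnT') (hnl.trans hnT')
      (fun u v _ _ => h u v) (w := z) (by nlinarith [norm_nonneg β])
    have h2 : (T : ℝ) ^ ((2 + 2 * L + J) * n) < 2 ^ T := by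
      exact_mod_cast hN n T hnN le_rfl
    have h3 : (T : ℝ) ^ (2 + 2 * L + T * J) ≤ (2 ^ T) ^ T := by
      calc (T : ℝ) ^ (2 + 2 * L + T * J) ≤ (T : ℝ) ^ ((2 + 2 * L + J) * n * T) := by
            refine pow_le_pow_right₀ ht ?_
            have : (2 + 2 * L + J) * (n * T) ≥ (2 + 2 * L) * 1 + J * T := by
              rw [add_mul _ J]
              gcongr
              · exact Nat.mul_pos hn1 hT1
              · exact Nat.le_mul_of_pos_left T hn1
            rw [mul_assoc, mul_comm T J]
            omega
        _ = ((T : ℝ) ^ ((2 + 2 * L + J) * n)) ^ T := pow_mul _ _ _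
        _ ≤ (2 ^ T) ^ T := by gcongr
    rw [le_div_iff₀ hn0]
    calc ‖expPoly l p z‖ * n
        ≤ ((L * J : ℕ) * P) * (T : ℝ) ^ (2 * L + T * J) * (1 / 2) ^ (T * T) * T := by
          rw [← mul_assoc] at h1
          gcongr
      _ ≤ T * (T : ℝ) ^ (2 * L + T * J) * (1 / 2) ^ (T * T) * T := by
          gcongr
          exact hnP.trans hnT'
      _ = (T : ℝ) ^ (2 + 2 * L + T * J) * (1 / 2) ^ (T * T) := by
          rw [add_assoc, pow_add _ 2]; ring
      _ ≤ (2 ^ T) ^ T * (1 / 2) ^ (T * T) := by gcongr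
      _ = 1 := by rw [← pow_mul, ← mul_pow]; norm_num
  have h0 : ‖expPoly l p z‖ ≤ 0 :=
    ge_of_tendsto (tendsto_const_div_atTop_nhds_zero_nat 1) hbound
  exact norm_le_zero_iff.mp h0

/-! ### Gelfond–Schneider -/

/-- Three numbers `exp l`, `β`, `exp (l * β)` with `l ≠ 0` and `β` irrational do not lie in a
common number field. -/
theorem false_of_exp_mem_numberField {d : ℕ} {a b c : 𝓞 K} (φ : K →+* ℂ) {l β : ℂ} (hd0 : d ≠ 0)
    (hl : l ≠ 0)
    (ha : φ a = d * Complex.exp l) (hb : φ b = d * β) (hc : φ c = d * Complex.exp (l * β))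
    (hβ : ∀ u v u' v' : ℕ, (u : ℂ) + v * β = u' + v' * β → u = u' ∧ v = v') : False := by
  set H : ℝ := 1 + d + house (a : K) + house (b : K) + house (c : K) with hHdef
  have ha0 := house_nonneg (a : K)
  have hb0 := house_nonneg (b : K)
  have hc0 := house_nonneg (c : K)
  have hd1 : (0 : ℝ) ≤ d := Nat.cast_nonneg d
  have hH : 1 ≤ H := by linarith
  have hd : (d : ℝ) ≤ H := by linarith
  have hha : house (a : K) ≤ H := by linarith
  have hhb : house (b : K) ≤ H := by linarith
  have hhc : house (c : K) ≤ H := by linarith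
  obtain ⟨C, hC⟩ := exists_auxiliary_expPoly φ hd0 ha hb hc hH hd hha hhb hhc
  obtain ⟨N, hN⟩ := exists_pow_mul_lt_two_pow (25 * Module.finrank ℚ K)
  obtain ⟨n, hn⟩ := ((Filter.eventually_ge_atTop N).and ((Filter.eventually_ge_atTop 2).and
    ((tendsto_natCast_atTop_atTop (R := ℝ)).eventually ((Filter.eventually_ge_atTop H).and
      ((Filter.eventually_ge_atTop C).and ((Filter.eventually_ge_atTop (5 * (1 + ‖β‖))).and
        (Filter.eventually_ge_atTop (Real.exp (‖l‖ * (5 * (1 + ‖β‖))))))))))).exists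
  obtain ⟨hnN, hn2, hnH, hnC, hnβ, hnl⟩ := hn
  obtain ⟨ξ, hξ0, hξ, hz⟩ := hC n hn2 hnH hnC
  have key : ∀ T : ℕ, n ^ 2 ≤ T → ∀ u v : ℕ, u < T → v < T →
      expPoly l (fun k => φ (ξ k)) (u + v * β) = 0 := by
    intro T hT
    induction T, hT using Nat.le_induction with
    | base => exact hz
    | succ T hT ih =>
      intro u v hu hv
      have hnT : n ≤ T := (Nat.le_self_pow (by norm_num) n).trans hT
      have hnT' : (n : ℝ) ≤ T := by exact_mod_cast hnT
      refine expPoly_eq_zero_of_forall_lt φ hd0 ha hb hc hβ hH hd hha hhb hhc (by omega)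
        (by omega) hT (hnH.trans hnT') (hnβ.trans hnT') (hnl.trans hnT') (hN n T hnN hT)
        (fun k => (hξ k).trans ?_) ih (by omega) (by omega)
      have hT1 : 1 ≤ T := by omega
      calc ((n ^ 2 : ℕ) : ℝ) ^ (13 * (n * n ^ 2)) ≤ (T : ℝ) ^ (13 * (n * n ^ 2)) := by gcongr
        _ ≤ (T : ℝ) ^ (13 * (n * T)) := by
          gcongr
          exact_mod_cast hT1
  have hzero := eq_zero_of_expPoly_eq_zero hl (expPoly_eq_zero_of_forall_nat hβ fun u v =>
    key (n ^ 2 + u + v + 1) (by omega) u v (by omega) (by omega))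
  refine hξ0 (funext fun k => ?_)
  have h1 : φ (ξ k) = 0 := congrFun hzero k
  have h2 : (ξ k : K) = 0 := (map_eq_zero φ).mp h1
  exact_mod_cast h2

end

/-- Irrationality makes the points u + vβ distinct, so a T × T grid really carries T² zeros. -/
theorem natCast_add_mul_injective {β : ℂ} (hβ : ¬ ∃ q : ℚ, β = (q : ℂ)) (u v u' v' : ℕ)
    (h : (u : ℂ) + v * β = u' + v' * β) : u = u' ∧ v = v' := by
  have hv : v = v' := by
    by_contra hne
    have hne' : (v : ℂ) - v' ≠ 0 := sub_ne_zero.mpr (by exact_mod_cast hne)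
    refine hβ ⟨((u' : ℚ) - u) / (v - v'), ?_⟩
    push_cast
    rw [eq_div_iff hne']
    linear_combination h
  subst hv
  exact ⟨by exact_mod_cast add_right_cancel h, rfl⟩

/-- The **Gelfond–Schneider theorem**. -/
theorem transcendental_exp_mul {l β : ℂ} (hl : l ≠ 0) (hexp : IsAlgebraic ℚ (Complex.exp l))
    (hβ : IsAlgebraic ℚ β) (hirr : ¬ ∃ q : ℚ, β = (q : ℂ)) :
    Transcendental ℚ (Complex.exp (l * β)) := by
  classical
  intro hγ
  let S : Set ℂ := {Complex.exp l, β, Complex.exp (l * β)}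
  let K := IntermediateField.adjoin ℚ S
  have hfin : FiniteDimensional ℚ K := by
    have : Finite S := Set.Finite.to_subtype (by simp [S])
    refine IntermediateField.finiteDimensional_adjoin fun x hx => ?_
    rcases hx with rfl | rfl | rfl
    exacts [hexp.isIntegral, hβ.isIntegral, hγ.isIntegral]
  have hNF : NumberField K := ⟨⟩
  have hS : ∀ x ∈ S, x ∈ K := fun x hx => IntermediateField.subset_adjoin ℚ S hx
  let x : K := ⟨Complex.exp l, hS _ (by simp [S])⟩
  let y : K := ⟨β, hS _ (by simp [S])⟩
  let z : K := ⟨Complex.exp (l * β), hS _ (by simp [S])⟩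
  obtain ⟨m, hm0, hm⟩ := exists_integral_multiples ℤ ℚ ({x, y, z} : Finset K)
  have hint : ∀ w ∈ ({x, y, z} : Finset K), ∃ a : 𝓞 K, (a : K) = m.natAbs * w := by
    intro w hw
    have h : IsIntegral ℤ ((m.natAbs : K) * w) := by
      have h1 := hm w hw
      rw [zsmul_eq_mul] at h1
      rcases Int.natAbs_eq m with h2 | h2
      · rw [h2, Int.cast_natCast] at h1
        exact h1
      · rw [h2] at h1
        simpa using h1.neg
    exact ⟨⟨_, h⟩, rfl⟩
  obtain ⟨a, ha⟩ := hint x (by simp)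
  obtain ⟨b, hb⟩ := hint y (by simp)
  obtain ⟨c, hc⟩ := hint z (by simp)
  refine false_of_exp_mem_numberField (a := a) (b := b) (c := c) (algebraMap K ℂ)
    (Int.natAbs_ne_zero.mpr hm0) hl ?_ ?_ ?_ (natCast_add_mul_injective hirr)
  · rw [ha, map_mul, map_natCast]; rfl
  · rw [hb, map_mul, map_natCast]; rfl
  · rw [hc, map_mul, map_natCast]; rfl

/-! ### Linear independence of 1, cosine and sine -/

/-- If `exp (I * w)` is transcendental, then `1`, `cos w`, `sin w` are linearly independent over
the algebraic numbers. -/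
theorem linearIndependent_one_cos_sin {w : ℂ}
    (hw : Transcendental ℚ (Complex.exp (w * Complex.I))) :
    LinearIndependent (algebraicClosure ℚ ℂ) ![(1 : ℂ), Complex.cos w, Complex.sin w] := by
  have hI : Complex.I ∈ algebraicClosure ℚ ℂ := by
    rw [mem_algebraicClosure_iff]
    exact (Complex.isIntegral_rat_I).isAlgebraic
  let J : algebraicClosure ℚ ℂ := ⟨Complex.I, hI⟩
  set γ := Complex.exp (w * Complex.I) with hγ
  have hγ' : Transcendental (algebraicClosure ℚ ℂ) γ := hw.algebraicClosure
  have hγ0 : γ * Complex.exp (-w * Complex.I) = 1 := by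
    rw [hγ, ← Complex.exp_add]; simp
  rw [Fintype.linearIndependent_iff]
  intro g hg
  simp only [Fin.sum_univ_three, Matrix.cons_val_zero, Matrix.cons_val_one, Matrix.cons_val,
    Algebra.smul_def, Complex.cos, Complex.sin, mul_one] at hg
  -- This is the relation multiplied by 2γ, with e^{-iw} eliminated by γ · e^{-iw} = 1.
  have hpoly : Polynomial.C (g 1 - g 2 * J) * Polynomial.X ^ 2 +
      Polynomial.C (2 * g 0) * Polynomial.X + Polynomial.C (g 1 + g 2 * J) = 0 := by
    refine (transcendental_iff.mp hγ') _ ?_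
    simp only [map_add, map_mul, map_sub, Polynomial.aeval_C, Polynomial.aeval_X, map_pow,
      map_ofNat]
    rw [show algebraMap (algebraicClosure ℚ ℂ) ℂ J = Complex.I from rfl]
    rw [← hγ] at hg
    linear_combination 2 * γ * hg - (algebraMap (algebraicClosure ℚ ℂ) ℂ (g 1) +
      algebraMap (algebraicClosure ℚ ℂ) ℂ (g 2) * Complex.I) * hγ0
  have h2 := congrArg (fun P => Polynomial.coeff P 2) hpoly
  have h1 := congrArg (fun P => Polynomial.coeff P 1) hpoly
  have h0 := congrArg (fun P => Polynomial.coeff P 0) hpoly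
  simp only [Polynomial.coeff_add, Polynomial.coeff_C_mul, Polynomial.coeff_X_pow,
    Polynomial.coeff_X, Polynomial.coeff_C, Polynomial.coeff_zero] at h0 h1 h2
  norm_num at h0 h1 h2
  have hJ0 : J ≠ 0 := fun h => Complex.I_ne_zero (congrArg Subtype.val h)
  have hg1 : g 1 = 0 := by linear_combination (h0 + h2) / 2
  have hg2 : g 2 = 0 := by
    rw [hg1, zero_add] at h0
    exact (mul_eq_zero.mp h0).resolve_right hJ0
  intro i
  fin_cases i
  exacts [h1, hg1, hg2]

theorem theorem7 (α β : ℂ) (hα : IsAlgebraic ℚ α) (hβ : IsAlgebraic ℚ β)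
    (hα0 : α ≠ 0) (hα1 : α ≠ 1) (hiβ : ¬ ∃ q : ℚ, Complex.I * β = (q : ℂ)) :
    LinearIndependent (algebraicClosure ℚ ℂ)
      ![(1 : ℂ), Complex.cos (β * Complex.log α), Complex.sin (β * Complex.log α)] ∧
    Transcendental ℚ (Complex.cos (β * Complex.log α)) ∧
    Transcendental ℚ (Complex.sin (β * Complex.log α)) := by
  have hl : Complex.log α ≠ 0 := by
    intro h
    apply hα1
    rw [← Complex.exp_log hα0, h, Complex.exp_zero]
  have hI : IsAlgebraic ℚ Complex.I := Complex.isIntegral_rat_I.isAlgebraic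
  have hγ := transcendental_exp_mul hl (by rwa [Complex.exp_log hα0]) (hI.mul hβ) hiβ
  rw [show Complex.log α * (Complex.I * β) = β * Complex.log α * Complex.I by ring] at hγ
  have hli := linearIndependent_one_cos_sin hγ
  refine ⟨hli, fun h => ?_, fun h => ?_⟩
  -- An algebraic value c of the cosine would give the nontrivial relation c · 1 − cos w = 0.
  · let c : algebraicClosure ℚ ℂ := ⟨_, mem_algebraicClosure_iff.mpr h⟩
    have := Fintype.linearIndependent_iff.mp hli ![c, -1, 0]
      (by simp [Fin.sum_univ_three, Algebra.smul_def, c]) 1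
    simp at this
  · let c : algebraicClosure ℚ ℂ := ⟨_, mem_algebraicClosure_iff.mpr h⟩
    have := Fintype.linearIndependent_iff.mp hli ![c, 0, -1]
      (by simp [Fin.sum_univ_three, Algebra.smul_def, c]) 2
    simp at this
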